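/- Let $x_1,\dots,x_n\in\mathbb{R}^d$ be distinct points whose convex hull $P=\mathrm{conv}(x_1,\dots,x_n)$ has dimension $d$, write $X=(x_1,\dots,x_n)$, and let $w\in\mathbb{R}^n$ satisfy $w_i>0$ for all $i$ and $\sum_{i=1}^n w_i=1$. For $y\in\mathbb{R}^n$ let the tent function $h_{X,y}:\mathbb{R}^d\to\mathbb{R}\cup\{-\infty\}$ be the smallest concave function $h$ with $h(x_i)\ge y_i$ for $i=1,\dots,n$; that is, $h_{X,y}(t)$ is the largest real number $r$ such that $(t,r)$ lies in the convex hull of $(x_1,y_1),\dots,(x_n,y_n)$ if $t\in P$, and $h_{X,y}(t)=-\infty$ if $t\notin P$. Let $f_{X,y}(t)=\exp(h_{X,y}(t))$ for $t\in P$ and $f_{X,y}(t)=0$ for $t\notin P$, and let $$\mathcal{S}(X)=\Bigl\{\,y\in\mathbb{R}^n \;:\; \int_P \exp(h_{X,y}(t))\,dt\le 1\Bigr\}$$ be the Samworth body of $X$. Then: 1. The linear functional $y\mapsto w\cdot y=\sum_{i=1}^n w_iy_i$ is bounded above on $\mathcal{S}(X)$. 2. Its maximum over $\mathcal{S}(X)$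 is attained at a unique point $y^*$. 3. The function $f_{X,y^*}$ is the unique optimal solution of the following problem: maximize $\sum_{i=1}^n w_i\log f(x_i)\in\mathbb{R}\cup\{-\infty\}$ (with $\log 0=-\infty$) over all integrable functions $f:\mathbb{R}^d\to\mathbb{R}_{\ge 0}$ such that $\log f:\mathbb{R}^d\to\mathbb{R}\cup\{-\infty\}$ is concave and $\int_{\mathbb{R}^d}f(x)\,dx=1$. Here uniqueness means equality as functions, at every point of $\mathbb{R}^d$. -/

import Mathlib

open MeasureTheory Set

namespace LogConcaveMLE

noncomputable section

/-- Concavity of a function `g : ℝ^d → [-∞, ∞]`.  It is used for functions that never take the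
value `+∞`, so that no sum below has the form `∞ - ∞`. -/
def IsConcave {d : ℕ} (g : EuclideanSpace ℝ (Fin d) → EReal) : Prop :=
  ∀ x y : EuclideanSpace ℝ (Fin d), ∀ a b : ℝ, 0 < a → 0 < b → a + b = 1 →
    (a : EReal) * g x + (b : EReal) * g y ≤ g (a • x + b • y)

/-- The polytope `P = conv(x₁, …, xₙ)`. -/
def polytope {d n : ℕ} (X : Fin n → EuclideanSpace ℝ (Fin d)) :
    Set (EuclideanSpace ℝ (Fin d)) :=
  convexHull ℝ (range X)

/-- The convex hull of the lifted points `(xᵢ, yᵢ)` in `ℝ^d × ℝ`. -/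
def liftedHull {d n : ℕ} (X : Fin n → EuclideanSpace ℝ (Fin d)) (y : Fin n → ℝ) :
    Set (EuclideanSpace ℝ (Fin d) × ℝ) :=
  convexHull ℝ (range fun i => (X i, y i))

/-- The tent function `h_{X,y}`: the upper hull of the points `(xᵢ, yᵢ)`, that is, the largest
`r` with `(t, r)` in their convex hull, and `-∞` if there is none (i.e. if `t ∉ P`).
It is the least concave function with `h(xᵢ) ≥ yᵢ`, see `tent_isLeast`. -/
def tent {d n : ℕ} (X : Fin n → EuclideanSpace ℝ (Fin d)) (y : Fin n → ℝ)
    (t : EuclideanSpace ℝ (Fin d)) : EReal :=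
  sSup ((fun r : ℝ => (r : EReal)) '' {r : ℝ | (t, r) ∈ liftedHull X y})

/-- The Samworth body `{y : ∫_P exp(h_{X,y}(t)) dt ≤ 1}`. -/
def samworthBody {d n : ℕ} (X : Fin n → EuclideanSpace ℝ (Fin d)) : Set (Fin n → ℝ) :=
  {y | ∫⁻ t in polytope X, EReal.exp (tent X y t) ≤ 1}

/-- The function `f_{X,y}`: equal to `exp(h_{X,y})` on `P` (where `h_{X,y}` is finite) and to `0`
elsewhere. -/
def tentDensity {d n : ℕ} (X : Fin n → EuclideanSpace ℝ (Fin d)) (y : Fin n → ℝ) :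
    EuclideanSpace ℝ (Fin d) → ℝ :=
  (polytope X).indicator fun t => Real.exp (tent X y t).toReal

/-- `log (f x)` with values in `ℝ ∪ {-∞}`, for `f ≥ 0`. -/
def extLog {d : ℕ} (f : EuclideanSpace ℝ (Fin d) → ℝ) (x : EuclideanSpace ℝ (Fin d)) : EReal :=
  ENNReal.log (ENNReal.ofReal (f x))

/-- Log-concave probability densities on `ℝ^d`. -/
structure IsLogConcaveDensity {d : ℕ} (f : EuclideanSpace ℝ (Fin d) → ℝ) : Prop where
  nonneg : ∀ x, 0 ≤ f x
  integrable : Integrable f volume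
  integral_eq_one : ∫ x, f x = 1
  log_concave : IsConcave (extLog f)

/-- The log-likelihood `∑ᵢ wᵢ log f(xᵢ)` of the weighted sample `(X, w)`, in `ℝ ∪ {-∞}`. -/
def logLikelihood {d n : ℕ} (X : Fin n → EuclideanSpace ℝ (Fin d)) (w : Fin n → ℝ)
    (f : EuclideanSpace ℝ (Fin d) → ℝ) : EReal :=
  ∑ i, (w i : EReal) * extLog f (X i)

/-- `f` is an optimal solution of: maximize the log-likelihood of `(X, w)` over all log-concave
probability densities. -/
def IsLogConcaveMLE {d n : ℕ} (X : Fin n → EuclideanSpace ℝ (Fin d)) (w : Fin n → ℝ)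
    (f : EuclideanSpace ℝ (Fin d) → ℝ) : Prop :=
  IsLogConcaveDensity f ∧
    ∀ g, IsLogConcaveDensity g → logLikelihood X w g ≤ logLikelihood X w f

/-- `y` is a maximizer of `y ↦ w · y` over the Samworth body. -/
def IsSamworthMaximizer {d n : ℕ} (X : Fin n → EuclideanSpace ℝ (Fin d)) (w : Fin n → ℝ)
    (y : Fin n → ℝ) : Prop :=
  y ∈ samworthBody X ∧ IsMaxOn (fun z : Fin n → ℝ => w ⬝ᵥ z) (samworthBody X) y

theorem le_tent {d n : ℕ} (X : Fin n → EuclideanSpace ℝ (Fin d)) (y : Fin n → ℝ) (i : Fin n) :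
    (y i : EReal) ≤ tent X y (X i) :=
  le_sSup ⟨y i, subset_convexHull ℝ _ ⟨i, rfl⟩, rfl⟩

theorem isCompact_liftedHull {d n : ℕ} (X : Fin n → EuclideanSpace ℝ (Fin d)) (y : Fin n → ℝ) :
    IsCompact (liftedHull X y) :=
  (finite_range _).isCompact_convexHull ℝ

theorem tent_eq_bot_or_mem {d n : ℕ} (X : Fin n → EuclideanSpace ℝ (Fin d)) (y : Fin n → ℝ)
    (t : EuclideanSpace ℝ (Fin d)) :
    tent X y t = ⊥ ∨ ∃ r : ℝ, (t, r) ∈ liftedHull X y ∧ tent X y t = r := by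
  have hc : IsCompact {r : ℝ | (t, r) ∈ liftedHull X y} := by
    have : {r : ℝ | (t, r) ∈ liftedHull X y} =
        Prod.snd '' (liftedHull X y ∩ Prod.fst ⁻¹' {t}) := by
      ext r
      simp
    rw [this]
    exact ((isCompact_liftedHull X y).inter_right
      (isClosed_singleton.preimage continuous_fst)).image continuous_snd
  rcases eq_empty_or_nonempty {r : ℝ | (t, r) ∈ liftedHull X y} with h | h
  · left
    simp [tent, h]
  · right
    obtain ⟨r, hr⟩ := hc.exists_isGreatest h
    refine ⟨r, hr.1, le_antisymm (sSup_le ?_) (le_sSup ⟨r, hr.1, rfl⟩)⟩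
    rintro _ ⟨s, hs, rfl⟩
    exact EReal.coe_le_coe_iff.2 (hr.2 hs)

theorem isConcave_tent {d n : ℕ} (X : Fin n → EuclideanSpace ℝ (Fin d)) (y : Fin n → ℝ) :
    IsConcave (tent X y) := by
  intro s t a b ha hb hab
  rcases tent_eq_bot_or_mem X y s with hs | ⟨r, hr, hs⟩
  · simp [hs, EReal.coe_mul_bot_of_pos ha]
  rcases tent_eq_bot_or_mem X y t with ht | ⟨q, hq, ht⟩
  · simp [ht, EReal.coe_mul_bot_of_pos hb]
  rw [hs, ht]
  refine le_sSup ⟨a * r + b * q, ?_, by push_cast; rfl⟩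
  exact convex_convexHull ℝ _ hr hq ha.le hb.le hab

/-- The tent function is the least concave function whose values at the points `xᵢ` are at least
`yᵢ`. -/
theorem tent_isLeast {d n : ℕ} (X : Fin n → EuclideanSpace ℝ (Fin d)) (y : Fin n → ℝ) :
    IsLeast {h : EuclideanSpace ℝ (Fin d) → EReal |
      IsConcave h ∧ (∀ t, h t ≠ ⊤) ∧ ∀ i, (y i : EReal) ≤ h (X i)} (tent X y) := by
  refine ⟨⟨isConcave_tent X y, fun t => ?_, le_tent X y⟩, ?_⟩
  · rcases tent_eq_bot_or_mem X y t with h | ⟨r, -, h⟩ <;> simp [h]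
  · rintro h ⟨hc, -, hy⟩ t
    have key : liftedHull X y ⊆ {p | (p.2 : EReal) ≤ h p.1} := by
      refine convexHull_min (by rintro _ ⟨i, rfl⟩; exact hy i) ?_
      rw [convex_iff_forall_pos]
      rintro ⟨s, r⟩ hr ⟨t, q⟩ hq a b ha hb hab
      refine le_trans ?_ (hc s t a b ha hb hab)
      have h1 : (a : EReal) * r ≤ a * h s :=
        mul_le_mul_of_nonneg_left hr (EReal.coe_nonneg.2 ha.le)
      have h2 : (b : EReal) * q ≤ b * h t :=
        mul_le_mul_of_nonneg_left hq (EReal.coe_nonneg.2 hb.le)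
      simpa using add_le_add h1 h2
    refine sSup_le ?_
    rintro _ ⟨r, hr, rfl⟩
    exact key hr

end

end LogConcaveMLE

open MeasureTheory Set Filter Topology

namespace LogConcaveMLE

/-! Existence is coercivity. If `y j` is the largest height and `y k` the smallest, shrinking `P`
towards `X j` by a factor `l` gives a set of volume `l ^ d * vol P` on which the tent is at least
`(1 - l) * y j + l * y k`. Mass at most one then bounds `y j` by a constant plus `l` times the
spread of `y`, while `w ⬝ᵥ y` lies below `y j` by at least `w k` times the spread. For small `l`
superlevel sets of `w ⬝ᵥ y` in the closed Samworth body are compact (`exists_coercivity_constants`).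

A maximizer has mass one and its tent passes through its heights. The tent is convex in the heights,
so the midpoint of two maximizers is again a maximizer; equality in AM-GM makes the two densities
agree a.e., and `le_tentDensity_of_ae_le` upgrades this to every point.

For a log-concave density `g` positive at all `X i`, the tent over `log (g (X i))` lies below `log
g`. These heights thus lie in the Samworth body, and the likelihood of `g` is `w` applied to them,
so the two problems have the same optimum. Equality forces the tent density below `g` to have the
same mass, hence to equal `g`. -/

/-- The convex hull of a finite family consists of its convex combinations. -/
theorem mem_convexHull_range_iff {E ι : Type*} [AddCommGroup E] [Module ℝ E] [Fintype ι]
    (v : ι → E) (x : E) :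
    x ∈ convexHull ℝ (range v) ↔ ∃ c ∈ stdSimplex ℝ ι, ∑ i, c i • v i = x := by
  classical
  constructor
  · intro hx
    have := LinearMap.image_convexHull (Fintype.linearCombination ℝ v)
      (range fun i j : ι => if i = j then (1 : ℝ) else 0)
    rw [convexHull_basis_eq_stdSimplex, ← range_comp] at this
    have h2 : ((Fintype.linearCombination ℝ v) ∘ fun i j : ι => if i = j then (1 : ℝ) else 0) = v := by
      ext i
      simp [Fintype.linearCombination_apply]
    rw [h2] at this
    rw [← this] at hx
    obtain ⟨c, hc, rfl⟩ := hx
    exact ⟨c, hc, (Fintype.linearCombination_apply ℝ v c).symm⟩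
  · rintro ⟨c, hc, rfl⟩
    exact (convex_convexHull ℝ _).sum_mem (fun i _ => hc.1 i) hc.2
      fun i _ => subset_convexHull ℝ _ ⟨i, rfl⟩

/-! ### Tent functions, their densities and the Samworth body -/

section Tent

variable {d n : ℕ} (X : Fin n → EuclideanSpace ℝ (Fin d)) (y : Fin n → ℝ)

theorem isCompact_polytope : IsCompact (polytope X) :=
  (finite_range _).isCompact_convexHull ℝ

theorem mem_liftedHull_iff (t : EuclideanSpace ℝ (Fin d)) (r : ℝ) :
    (t, r) ∈ liftedHull X y ↔
      ∃ c ∈ stdSimplex ℝ (Fin n), ∑ i, c i • X i = t ∧ ∑ i, c i * y i = r := by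
  rw [liftedHull, mem_convexHull_range_iff]
  simp [Prod.ext_iff, Prod.fst_sum, Prod.snd_sum]

variable {X} {y} {t : EuclideanSpace ℝ (Fin d)}

theorem mem_polytope_iff :
    t ∈ polytope X ↔ ∃ c ∈ stdSimplex ℝ (Fin n), ∑ i, c i • X i = t :=
  mem_convexHull_range_iff X t

theorem exists_tent_eq_of_mem (ht : t ∈ polytope X) :
    ∃ r : ℝ, (t, r) ∈ liftedHull X y ∧ tent X y t = r := by
  refine (tent_eq_bot_or_mem X y t).resolve_left fun h => ?_
  obtain ⟨c, hc, hct⟩ := mem_polytope_iff.1 ht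
  have : ((∑ i, c i * y i : ℝ) : EReal) ≤ tent X y t :=
    le_sSup ⟨_, (mem_liftedHull_iff X y t _).2 ⟨c, hc, hct, rfl⟩, rfl⟩
  rw [h, le_bot_iff] at this
  exact EReal.coe_ne_bot _ this

theorem tent_of_notMem (ht : t ∉ polytope X) : tent X y t = ⊥ := by
  refine (tent_eq_bot_or_mem X y t).resolve_right ?_
  rintro ⟨r, hr, -⟩
  obtain ⟨c, hc, hct, -⟩ := (mem_liftedHull_iff X y t r).1 hr
  exact ht (mem_polytope_iff.2 ⟨c, hc, hct⟩)

theorem coe_toReal_tent (ht : t ∈ polytope X) : ((tent X y t).toReal : EReal) = tent X y t := by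
  obtain ⟨r, -, h⟩ := exists_tent_eq_of_mem (y := y) ht
  rw [h, EReal.toReal_coe]

theorem exists_weights_tent (ht : t ∈ polytope X) :
    ∃ c ∈ stdSimplex ℝ (Fin n), ∑ i, c i • X i = t ∧ ∑ i, c i * y i = (tent X y t).toReal := by
  obtain ⟨r, hr, h⟩ := exists_tent_eq_of_mem (y := y) ht
  rw [h, EReal.toReal_coe]
  exact (mem_liftedHull_iff X y t r).1 hr

theorem le_toReal_tent {c : Fin n → ℝ} (hc : c ∈ stdSimplex ℝ (Fin n))
    (hct : ∑ i, c i • X i = t) : ∑ i, c i * y i ≤ (tent X y t).toReal := by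
  rw [← EReal.coe_le_coe_iff, coe_toReal_tent (mem_polytope_iff.2 ⟨c, hc, hct⟩)]
  exact le_sSup ⟨_, (mem_liftedHull_iff X y t _).2 ⟨c, hc, hct, rfl⟩, rfl⟩

theorem mem_polytope_self (i : Fin n) : X i ∈ polytope X := subset_convexHull ℝ _ ⟨i, rfl⟩

theorem le_toReal_tent_self (i : Fin n) : y i ≤ (tent X y (X i)).toReal := by
  rw [← EReal.coe_le_coe_iff, coe_toReal_tent (mem_polytope_self i)]
  exact le_tent X y i

/-- Weights realising the tent over `y` at `t` also compete for the tent over `z`. This single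
estimate covers monotonicity, shifts and Lipschitz dependence on the heights. -/
theorem toReal_tent_le_add {z : Fin n → ℝ} {a : ℝ} (h : ∀ i, y i ≤ z i + a)
    (ht : t ∈ polytope X) : (tent X y t).toReal ≤ (tent X z t).toReal + a := by
  obtain ⟨c, hc, hct, hcy⟩ := exists_weights_tent (y := y) ht
  have h1 : ∑ i, c i * y i ≤ ∑ i, c i * (z i + a) :=
    Finset.sum_le_sum fun i _ => mul_le_mul_of_nonneg_left (h i) (hc.1 i)
  have h2 : ∑ i, c i * (z i + a) = ∑ i, c i * z i + a := by
    simp_rw [mul_add, Finset.sum_add_distrib, ← Finset.sum_mul, hc.2, one_mul]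
  linarith [le_toReal_tent (y := z) hc hct]

theorem toReal_tent_le {a : ℝ} (h : ∀ i, y i ≤ a) (ht : t ∈ polytope X) :
    (tent X y t).toReal ≤ a := by
  obtain ⟨c, hc, -, hcy⟩ := exists_weights_tent (y := y) ht
  rw [← hcy]
  calc ∑ i, c i * y i ≤ ∑ i, c i * a :=
        Finset.sum_le_sum fun i _ => mul_le_mul_of_nonneg_left (h i) (hc.1 i)
    _ = a := by rw [← Finset.sum_mul, hc.2, one_mul]

theorem le_toReal_tent_of_le {a : ℝ} (h : ∀ i, a ≤ y i) (ht : t ∈ polytope X) :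
    a ≤ (tent X y t).toReal := by
  obtain ⟨c, hc, hct⟩ := mem_polytope_iff.1 ht
  refine le_trans ?_ (le_toReal_tent hc hct)
  calc a = ∑ i, c i * a := by rw [← Finset.sum_mul, hc.2, one_mul]
    _ ≤ ∑ i, c i * y i :=
        Finset.sum_le_sum fun i _ => mul_le_mul_of_nonneg_left (h i) (hc.1 i)

/-- The tent function is midpoint convex as a function of the heights. -/
theorem toReal_tent_midpoint_le {z : Fin n → ℝ} (ht : t ∈ polytope X) :
    (tent X (fun i => (y i + z i) / 2) t).toReal ≤
      ((tent X y t).toReal + (tent X z t).toReal) / 2 := by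
  obtain ⟨c, hc, hct, hcy⟩ := exists_weights_tent (y := fun i => (y i + z i) / 2) ht
  have h1 : ∑ i, c i * ((y i + z i) / 2) = (∑ i, c i * y i + ∑ i, c i * z i) / 2 := by
    rw [← Finset.sum_add_distrib, Finset.sum_div]
    exact Finset.sum_congr rfl fun i _ => by ring
  linarith [le_toReal_tent (y := y) hc hct, le_toReal_tent (y := z) hc hct]

/-- Replacing the heights by the values of the tent function does not change the tent. -/
theorem toReal_tent_tent (ht : t ∈ polytope X) :
    (tent X (fun i => (tent X y (X i)).toReal) t).toReal = (tent X y t).toReal := by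
  refine le_antisymm ?_ ?_
  · have h := (tent_isLeast X (fun i => (tent X y (X i)).toReal)).2
      (⟨isConcave_tent X y, (tent_isLeast X y).1.2.1,
        fun i => (coe_toReal_tent (mem_polytope_self i)).le⟩) t
    exact EReal.coe_le_coe_iff.1 (by rwa [coe_toReal_tent ht, coe_toReal_tent ht])
  · simpa using toReal_tent_le_add (X := X) (y := y) (z := fun i => (tent X y (X i)).toReal)
      (a := 0) (fun i => by simpa using le_toReal_tent_self i) ht

theorem tentDensity_of_mem (ht : t ∈ polytope X) :
    tentDensity X y t = Real.exp (tent X y t).toReal := indicator_of_mem ht _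

theorem tentDensity_of_notMem (ht : t ∉ polytope X) : tentDensity X y t = 0 :=
  indicator_of_notMem ht _

theorem tentDensity_nonneg (t : EuclideanSpace ℝ (Fin d)) : 0 ≤ tentDensity X y t :=
  indicator_nonneg (fun _ _ => (Real.exp_pos _).le) t

theorem exp_tent (t : EuclideanSpace ℝ (Fin d)) :
    EReal.exp (tent X y t) = ENNReal.ofReal (tentDensity X y t) := by
  by_cases ht : t ∈ polytope X
  · rw [tentDensity_of_mem ht, ← EReal.exp_coe, coe_toReal_tent ht]
  · rw [tentDensity_of_notMem ht, tent_of_notMem ht]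
    simp

theorem extLog_tentDensity : extLog (tentDensity X y) = tent X y := by
  funext t
  rw [extLog, ← exp_tent, EReal.log_exp]

theorem tentDensity_le_exp_mul {z : Fin n → ℝ} {a : ℝ} (h : ∀ i, y i ≤ z i + a)
    (t : EuclideanSpace ℝ (Fin d)) : tentDensity X y t ≤ Real.exp a * tentDensity X z t := by
  by_cases ht : t ∈ polytope X
  · rw [tentDensity_of_mem ht, tentDensity_of_mem ht, ← Real.exp_add, Real.exp_le_exp, add_comm]
    exact toReal_tent_le_add h ht
  · simp [tentDensity_of_notMem ht]

/-- Upper semicontinuity: for `c > 0` the superlevel set is the projection of a compact slice of the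
lifted hull. -/
theorem isClosed_le_tentDensity (c : ℝ) : IsClosed {t | c ≤ tentDensity X y t} := by
  rcases le_or_gt c 0 with hc | hc
  · convert isClosed_univ
    exact eq_univ_of_forall fun t => hc.trans (tentDensity_nonneg t)
  · have : {t | c ≤ tentDensity X y t} =
        Prod.fst '' (liftedHull X y ∩ {p | Real.log c ≤ p.2}) := by
      ext t
      constructor
      · intro h
        have ht : t ∈ polytope X := by
          by_contra ht
          rw [mem_ofPred_eq, tentDensity_of_notMem ht] at h
          exact absurd h hc.not_ge
        rw [mem_ofPred_eq, tentDensity_of_mem ht] at h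
        obtain ⟨r, hr, h'⟩ := exists_tent_eq_of_mem (y := y) ht
        rw [h', EReal.toReal_coe] at h
        exact ⟨(t, r), ⟨hr, (Real.log_le_iff_le_exp hc).2 h⟩, rfl⟩
      · rintro ⟨⟨s, r⟩, ⟨hr, hcr⟩, rfl⟩
        obtain ⟨u, hu, hut, hur⟩ := (mem_liftedHull_iff X y s r).1 hr
        rw [mem_ofPred_eq, tentDensity_of_mem (mem_polytope_iff.2 ⟨u, hu, hut⟩),
          ← Real.log_le_iff_le_exp hc]
        exact le_trans hcr (hur ▸ le_toReal_tent hu hut)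
    rw [this]
    exact (((isCompact_liftedHull X y).inter_right
      (isClosed_le continuous_const continuous_snd)).image continuous_fst).isClosed

variable (X y)

theorem measurable_tentDensity : Measurable (tentDensity X y) :=
  measurable_of_Ici fun c => (isClosed_le_tentDensity c).measurableSet

theorem integrable_tentDensity : Integrable (tentDensity X y) := by
  have hP : volume (polytope X) < ⊤ := (isCompact_polytope X).measure_lt_top
  have hmeas : MeasurableSet (polytope X) := (isCompact_polytope X).measurableSet
  refine Integrable.mono' (g := (polytope X).indicator fun _ => Real.exp (∑ i, |y i|))
    ((integrable_indicator_iff hmeas).2 (integrableOn_const hP.ne))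
    (measurable_tentDensity X y).aestronglyMeasurable (Eventually.of_forall fun t => ?_)
  rw [Real.norm_of_nonneg (tentDensity_nonneg t)]
  refine indicator_le_indicator' fun ht => Real.exp_le_exp.2 (toReal_tent_le (fun i => ?_) ht)
  exact (le_abs_self _).trans
    (Finset.single_le_sum (f := fun i => |y i|) (fun i _ => abs_nonneg _) (Finset.mem_univ i))

theorem mem_samworthBody_iff : y ∈ samworthBody X ↔ ∫ t, tentDensity X y t ≤ 1 := by
  have h : ∫⁻ t in polytope X, EReal.exp (tent X y t) =
      ENNReal.ofReal (∫ t, tentDensity X y t) := by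
    rw [ofReal_integral_eq_lintegral_ofReal (integrable_tentDensity X y)
      (Eventually.of_forall tentDensity_nonneg)]
    simp_rw [exp_tent]
    refine setLIntegral_eq_of_support_subset fun t ht => ?_
    by_contra h
    exact ht (by simp [tentDensity_of_notMem h])
  rw [samworthBody, mem_ofPred_eq, h, ENNReal.ofReal_le_one]

theorem integral_tentDensity_le_exp_mul {z : Fin n → ℝ} {a : ℝ} (h : ∀ i, y i ≤ z i + a) :
    ∫ t, tentDensity X y t ≤ Real.exp a * ∫ t, tentDensity X z t := by
  rw [← integral_const_mul]
  exact integral_mono (integrable_tentDensity X y) ((integrable_tentDensity X z).const_mul _)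
    (tentDensity_le_exp_mul h)

end Tent

/-! ### Coercivity, uniqueness, and comparison with log-concave densities -/

section Likelihood

variable {d n : ℕ} {X : Fin n → EuclideanSpace ℝ (Fin d)} {y w : Fin n → ℝ}
  {g : EuclideanSpace ℝ (Fin d) → ℝ}

theorem volume_polytope_pos (hdim : affineSpan ℝ (range X) = ⊤) : 0 < volume (polytope X) :=
  Measure.measure_pos_of_nonempty_interior _ (interior_convexHull_nonempty_iff_affineSpan_eq_top.2 hdim)

theorem IsConcave.exp_le_of_extLog (hg : IsConcave (extLog g)) {s t : EuclideanSpace ℝ (Fin d)}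
    (hs : 0 < g s) (ht : 0 < g t) {a b : ℝ} (ha : 0 < a) (hb : 0 < b) (hab : a + b = 1) :
    Real.exp (a * Real.log (g s) + b * Real.log (g t)) ≤ g (a • s + b • t) := by
  have h := EReal.exp_monotone (hg s t a b ha hb hab)
  rw [extLog, extLog, extLog, ENNReal.exp_log, ENNReal.log_ofReal_of_pos hs,
    ENNReal.log_ofReal_of_pos ht, ← EReal.coe_mul, ← EReal.coe_mul, ← EReal.coe_add,
    EReal.exp_coe, ENNReal.ofReal_le_ofReal_iff'] at h
  exact h.resolve_right (Real.exp_pos _).not_ge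

theorem homothety_eq_convex_combination (p q : EuclideanSpace ℝ (Fin d)) (l : ℝ) :
    AffineMap.homothety p l q = (1 - l) • p + l • q := by
  rw [AffineMap.homothety_apply, vsub_eq_sub, vadd_eq_add, smul_sub, sub_smul, one_smul]
  abel

/-- A lower bound for a log-concave function on a homothetic copy of a set. -/
theorem IsConcave.exp_le_of_mem_homothety (hg : IsConcave (extLog g))
    {P : Set (EuclideanSpace ℝ (Fin d))} {k : ℝ} (hk : 0 < k) (hkP : ∀ t ∈ P, k ≤ g t)
    {p : EuclideanSpace ℝ (Fin d)} (hp : 0 < g p) {l : ℝ} (hl0 : 0 < l) (hl1 : l < 1)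
    {s : EuclideanSpace ℝ (Fin d)} (hs : s ∈ AffineMap.homothety p l '' P) :
    Real.exp ((1 - l) * Real.log (g p) + l * Real.log k) ≤ g s := by
  obtain ⟨q, hq, rfl⟩ := hs
  rw [homothety_eq_convex_combination]
  refine le_trans ?_ (hg.exp_le_of_extLog hp (hk.trans_le (hkP q hq)) (sub_pos.2 hl1) hl0
    (by ring))
  gcongr
  exact hkP q hq

theorem tentDensity_lower_bound {m : ℝ} (hm : ∀ i, m ≤ y i) {t : EuclideanSpace ℝ (Fin d)}
    (ht : t ∈ polytope X) : Real.exp m ≤ tentDensity X y t := by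
  rw [tentDensity_of_mem ht]
  exact Real.exp_le_exp.2 (le_toReal_tent_of_le hm ht)

theorem exists_tentDensity_lower_bound (X : Fin n → EuclideanSpace ℝ (Fin d)) (y : Fin n → ℝ) :
    ∃ k, 0 < k ∧ ∀ t ∈ polytope X, k ≤ tentDensity X y t := by
  refine ⟨Real.exp (-∑ i, |y i|), Real.exp_pos _, fun t ht =>
    tentDensity_lower_bound (fun i => ?_) ht⟩
  exact (neg_le_neg (Finset.single_le_sum (f := fun i => |y i|) (fun i _ => abs_nonneg _)
    (Finset.mem_univ i))).trans (neg_abs_le _)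

theorem isConcave_extLog_tentDensity : IsConcave (extLog (tentDensity X y)) := by
  rw [extLog_tentDensity]
  exact isConcave_tent X y

/-- A log-concave function that is bounded below on the polytope and almost everywhere at most the
tent density is so everywhere. -/
theorem le_tentDensity_of_ae_le (hdim : affineSpan ℝ (range X) = ⊤) (hg : IsConcave (extLog g))
    {k : ℝ} (hk : 0 < k) (hkP : ∀ t ∈ polytope X, k ≤ g t)
    (hae : ∀ᵐ t, g t ≤ tentDensity X y t) (p : EuclideanSpace ℝ (Fin d)) :
    g p ≤ tentDensity X y p := by
  by_contra! hlt
  have hp : 0 < g p := (tentDensity_nonneg p).trans_lt hlt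
  -- The level `c` separates the two functions near `p`: the tent density stays below `c` on a ball,
  -- and `g` stays above `c` on a small homothetic copy of `P`, which has positive volume even if `p
  -- ∉ P`.
  obtain ⟨c, hc1, hc2⟩ := exists_between hlt
  have hU : IsOpen {t | tentDensity X y t < c} := by
    have := (isClosed_le_tentDensity (X := X) (y := y) c).isOpen_compl
    convert this using 1
    ext t
    simp
  obtain ⟨ε, hε, hball⟩ := Metric.isOpen_iff.1 hU p hc1
  obtain ⟨R, hR⟩ := (isCompact_polytope X).isBounded.subset_closedBall p
  have hlim1 : ∀ᶠ l : ℝ in 𝓝 0, l * R < ε := by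
    have : Tendsto (fun l : ℝ => l * R) (𝓝 0) (𝓝 (0 * R)) :=
      (continuous_id.mul continuous_const).tendsto 0
    rw [zero_mul] at this
    exact this.eventually (gt_mem_nhds hε)
  have hlim2 : ∀ᶠ l : ℝ in 𝓝 0, c < Real.exp ((1 - l) * Real.log (g p) + l * Real.log k) := by
    have : Continuous fun l : ℝ => Real.exp ((1 - l) * Real.log (g p) + l * Real.log k) := by
      fun_prop
    have h0 := this.tendsto 0
    simp only [sub_zero, one_mul, zero_mul, add_zero, Real.exp_log hp] at h0
    exact h0.eventually (lt_mem_nhds hc2)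
  have hlim3 : ∀ᶠ l : ℝ in 𝓝 0, l < 1 := gt_mem_nhds one_pos
  obtain ⟨l, ⟨h1, h2, hl1⟩, hl0⟩ := ((((hlim1.and (hlim2.and hlim3)).filter_mono
    nhdsWithin_le_nhds).and (self_mem_nhdsWithin : Ioi (0 : ℝ) ∈ 𝓝[>] 0)).exists)
  have hl0 : 0 < l := hl0
  have hsub : AffineMap.homothety p l '' polytope X ⊆ {t | ¬ g t ≤ tentDensity X y t} := by
    intro s hs
    have hgs := hg.exp_le_of_mem_homothety hk hkP hp hl0 hl1 hs
    have hsU : tentDensity X y s < c := by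
      apply hball
      obtain ⟨q, hq, rfl⟩ := hs
      rw [Metric.mem_ball, dist_homothety_center, Real.norm_of_nonneg hl0.le]
      have := hR hq
      rw [Metric.mem_closedBall, dist_comm] at this
      exact (mul_le_mul_of_nonneg_left this hl0.le).trans_lt h1
    exact not_le.2 (hsU.trans (h2.trans_le hgs))
  have hpos : 0 < volume (AffineMap.homothety p l '' polytope X) := by
    rw [Measure.addHaar_image_homothety]
    exact ENNReal.mul_pos (by simp [hl0.ne']) (volume_polytope_pos hdim).ne'
  exact hpos.ne' (measure_mono_null hsub hae)

theorem le_integral_tentDensity {m : ℝ} (hm : ∀ i, m ≤ y i) (j : Fin n) {l : ℝ} (hl0 : 0 < l)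
    (hl1 : l < 1) :
    l ^ d * volume.real (polytope X) * Real.exp ((1 - l) * y j + l * m) ≤
      ∫ t, tentDensity X y t := by
  have hA : IsCompact (AffineMap.homothety (X j) l '' polytope X) :=
    (isCompact_polytope X).image (AffineMap.homothety_continuous _ _)
  have hvol : volume.real (AffineMap.homothety (X j) l '' polytope X) =
      l ^ d * volume.real (polytope X) := by
    rw [measureReal_def, Measure.addHaar_image_homothety, ENNReal.toReal_mul,
      ENNReal.toReal_ofReal (abs_nonneg _), finrank_euclideanSpace_fin,
      abs_of_pos (pow_pos hl0 d), measureReal_def]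
  have hXj : Real.exp (y j) ≤ tentDensity X y (X j) := by
    rw [tentDensity_of_mem (mem_polytope_self j)]
    exact Real.exp_le_exp.2 (le_toReal_tent_self j)
  have hle : ∀ s ∈ AffineMap.homothety (X j) l '' polytope X,
      Real.exp ((1 - l) * y j + l * m) ≤ tentDensity X y s := by
    intro s hs
    have hpos := (Real.exp_pos _).trans_le hXj
    refine le_trans ?_ (isConcave_extLog_tentDensity.exp_le_of_mem_homothety (Real.exp_pos m)
      (fun t ht => tentDensity_lower_bound hm ht) hpos hl0 hl1 hs)
    rw [Real.log_exp, Real.exp_le_exp]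
    have := mul_le_mul_of_nonneg_left ((Real.le_log_iff_exp_le hpos).2 hXj) (sub_pos.2 hl1).le
    linarith
  rw [← hvol, mul_comm]
  refine (setIntegral_ge_of_const_le_real hA.measurableSet hA.measure_lt_top.ne hle
    (integrable_tentDensity X y).integrableOn).trans ?_
  exact setIntegral_le_integral (integrable_tentDensity X y)
    (Eventually.of_forall tentDensity_nonneg)

theorem volume_real_polytope_pos (hdim : affineSpan ℝ (range X) = ⊤) :
    0 < volume.real (polytope X) :=
  ENNReal.toReal_pos (volume_polytope_pos hdim).ne' (isCompact_polytope X).measure_lt_top.ne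

theorem integral_tentDensity_pos (hdim : affineSpan ℝ (range X) = ⊤) (y : Fin n → ℝ) :
    0 < ∫ t, tentDensity X y t := by
  rw [integral_pos_iff_support_of_nonneg tentDensity_nonneg (integrable_tentDensity X y)]
  refine (volume_polytope_pos hdim).trans_le (measure_mono fun t ht => ?_)
  rw [Function.mem_support, tentDensity_of_mem ht]
  exact (Real.exp_pos _).ne'

/-- Shifting the heights so that the total mass becomes one. -/
theorem sub_log_integral_mem_samworthBody (hdim : affineSpan ℝ (range X) = ⊤) (y : Fin n → ℝ) :
    (fun i => y i - Real.log (∫ t, tentDensity X y t)) ∈ samworthBody X := by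
  have hpos := integral_tentDensity_pos hdim y
  rw [mem_samworthBody_iff]
  refine (integral_tentDensity_le_exp_mul X _ (z := y)
    (a := -Real.log (∫ t, tentDensity X y t)) fun i => by simp [sub_eq_add_neg]).trans ?_
  rw [Real.exp_neg, Real.exp_log hpos, inv_mul_cancel₀ hpos.ne']

/-- Moving the heights by sup-distance `r` changes the mass by a factor at most `exp r`. -/
theorem isClosed_samworthBody (X : Fin n → EuclideanSpace ℝ (Fin d)) :
    IsClosed (samworthBody X) := by
  refine IsSeqClosed.isClosed fun u y hu hy => ?_
  rw [mem_samworthBody_iff]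
  have hlim : Tendsto (fun k => Real.exp (dist (u k) y)) atTop (𝓝 1) := by
    have := (Real.continuous_exp.tendsto 0).comp (tendsto_iff_dist_tendsto_zero.1 hy)
    rwa [Real.exp_zero] at this
  refine ge_of_tendsto' hlim fun k => ?_
  have h1 : ∀ i, y i ≤ u k i + dist (u k) y := fun i => by
    linarith [abs_le.1 (le_of_eq_of_le (Real.dist_eq _ _).symm (dist_le_pi_dist (u k) y i))]
  exact (integral_tentDensity_le_exp_mul X y h1).trans
    (mul_le_of_le_one_right (Real.exp_pos _).le ((mem_samworthBody_iff X _).1 (hu k)))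

/-- All terms of `∑ i, w i * (y j - y i)` are nonnegative; only the `k`-th is kept. -/
theorem dotProduct_le_sub {j k : Fin n} (hw : ∀ i, 0 < w i) (hw1 : ∑ i, w i = 1)
    (hj : ∀ i, y i ≤ y j) : w ⬝ᵥ y ≤ y j - w k * (y j - y k) := by
  have h := Finset.single_le_sum (f := fun i => w i * (y j - y i))
    (fun i _ => mul_nonneg (hw i).le (sub_nonneg.2 (hj i))) (Finset.mem_univ k)
  simp only [mul_sub, Finset.sum_sub_distrib, ← Finset.sum_mul, hw1, one_mul] at h
  rw [dotProduct]
  linarith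

theorem nonempty_of_sum_eq_one (hw1 : ∑ i, w i = 1) : Nonempty (Fin n) := by
  by_contra h
  rw [not_nonempty_iff] at h
  simp at hw1

/-- Coercivity of `y ↦ w · y` on the Samworth body. -/
theorem exists_coercivity_constants (hdim : affineSpan ℝ (range X) = ⊤) (hw : ∀ i, 0 < w i)
    (hw1 : ∑ i, w i = 1) :
    ∃ C δ : ℝ, 0 < δ ∧ ∀ y ∈ samworthBody X, ∀ j k : Fin n, (∀ i, y i ≤ y j) →
      (∀ i, y k ≤ y i) →
      w ⬝ᵥ y ≤ C - δ * (y j - y k) ∧ y j ≤ C + δ * (y j - y k) := by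
  have hne := nonempty_of_sum_eq_one hw1
  obtain ⟨k₀, hk₀⟩ := Finite.exists_min w
  have hle1 : w k₀ ≤ 1 :=
    hw1 ▸ Finset.single_le_sum (fun i _ => (hw i).le) (Finset.mem_univ k₀)
  have hV := volume_real_polytope_pos hdim
  -- Half of the smallest weight: one half of the gain `w k * (y j - y k)` absorbs the growth of `y
  -- j`, the other half remains as decay.
  set δ := w k₀ / 2 with hδ
  have hδ0 : 0 < δ := half_pos (hw k₀)
  have hc : 0 < δ ^ d * volume.real (polytope X) := by positivity
  refine ⟨-Real.log (δ ^ d * volume.real (polytope X)), δ, hδ0, fun y hy j k hj hk => ?_⟩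
  have h2 : y j ≤ -Real.log (δ ^ d * volume.real (polytope X)) + δ * (y j - y k) := by
    have h := (le_integral_tentDensity (X := X) hk j hδ0 (by linarith)).trans
      ((mem_samworthBody_iff X y).1 hy)
    have h' := Real.log_nonpos (by positivity) h
    rw [Real.log_mul hc.ne' (Real.exp_pos _).ne', Real.log_exp] at h'
    linarith
  refine ⟨?_, h2⟩
  have h3 := dotProduct_le_sub (k := k) hw hw1 hj
  have h4 : w k₀ * (y j - y k) ≤ w k * (y j - y k) :=
    mul_le_mul_of_nonneg_right (hk₀ k) (sub_nonneg.2 (hj k))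
  have h5 : w k₀ * (y j - y k) = δ * (y j - y k) + δ * (y j - y k) := by rw [hδ]; ring
  linarith

theorem bddAbove_dotProduct_samworthBody (hdim : affineSpan ℝ (range X) = ⊤) (hw : ∀ i, 0 < w i)
    (hw1 : ∑ i, w i = 1) :
    BddAbove ((fun y : Fin n → ℝ => w ⬝ᵥ y) '' samworthBody X) := by
  obtain ⟨C, δ, hδ, h⟩ := exists_coercivity_constants hdim hw hw1
  have hne := nonempty_of_sum_eq_one hw1
  refine ⟨C, ?_⟩
  rintro _ ⟨y, hy, rfl⟩
  obtain ⟨j, hj⟩ := Finite.exists_max y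
  obtain ⟨k, hk⟩ := Finite.exists_min y
  have := mul_nonneg hδ.le (sub_nonneg.2 (hj k))
  linarith [(h y hy j k hj hk).1]

theorem exists_isSamworthMaximizer (hdim : affineSpan ℝ (range X) = ⊤) (hw : ∀ i, 0 < w i)
    (hw1 : ∑ i, w i = 1) : ∃ y, IsSamworthMaximizer X w y := by
  obtain ⟨C, δ, hδ, h⟩ := exists_coercivity_constants hdim hw hw1
  have hne := nonempty_of_sum_eq_one hw1
  obtain ⟨y₀, hy₀⟩ : (samworthBody X).Nonempty := ⟨_, sub_log_integral_mem_samworthBody hdim 0⟩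
  have hcont : Continuous fun z : Fin n → ℝ => w ⬝ᵥ z := by
    unfold dotProduct
    fun_prop
  set c := w ⬝ᵥ y₀ with hc
  -- On the superlevel set at `c`, coercivity bounds the spread by `D`; since the largest height is
  -- at least `w ⬝ᵥ y ≥ c`, all heights lie in `[c - D, C + δ * D]`.
  set D := (C - c) / δ with hD
  have hK : IsCompact (samworthBody X ∩ {z | c ≤ w ⬝ᵥ z}) := by
    refine (isCompact_Icc (a := fun _ : Fin n => c - D) (b := fun _ => C + δ * D)).of_isClosed_subset
      ((isClosed_samworthBody X).inter (isClosed_le continuous_const hcont)) ?_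
    rintro y ⟨hy, hcy⟩
    have hcy : c ≤ w ⬝ᵥ y := hcy
    obtain ⟨j, hj⟩ := Finite.exists_max y
    obtain ⟨k, hk⟩ := Finite.exists_min y
    obtain ⟨h1, h2⟩ := h y hy j k hj hk
    have hΔ : y j - y k ≤ D := by
      rw [hD, le_div_iff₀ hδ, mul_comm]
      linarith
    have h3 := dotProduct_le_sub (k := j) hw hw1 hj
    have h4 := mul_le_mul_of_nonneg_left hΔ hδ.le
    refine ⟨fun i => ?_, fun i => ?_⟩
    · have := hk i
      simp only [sub_self, mul_zero, sub_zero] at h3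
      change c - D ≤ y i
      linarith
    · exact (hj i).trans (by linarith)
  obtain ⟨y, ⟨hy, hcy⟩, hmax⟩ := hK.exists_isMaxOn ⟨y₀, hy₀, hc.le⟩ hcont.continuousOn
  refine ⟨y, hy, fun z hz => ?_⟩
  rcases le_or_gt c (w ⬝ᵥ z) with hz' | hz'
  · exact hmax ⟨hz, hz'⟩
  · exact hz'.le.trans hcy

/-- With mass below one, all heights could be raised by the same positive amount. -/
theorem IsSamworthMaximizer.integral_eq_one (hdim : affineSpan ℝ (range X) = ⊤)
    (hw1 : ∑ i, w i = 1) (h : IsSamworthMaximizer X w y) : ∫ t, tentDensity X y t = 1 := by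
  have hpos := integral_tentDensity_pos hdim y
  refine le_antisymm ((mem_samworthBody_iff X y).1 h.1) ?_
  have h1 : w ⬝ᵥ (fun i => y i - Real.log (∫ t, tentDensity X y t)) ≤ w ⬝ᵥ y :=
    h.2 (sub_log_integral_mem_samworthBody hdim y)
  simp only [dotProduct, mul_sub, Finset.sum_sub_distrib, ← Finset.sum_mul, hw1, one_mul] at h1
  exact (Real.log_nonneg_iff hpos).1 (by linarith)

/-- Lifting a height up to the tent leaves the density unchanged but would increase `w ⬝ᵥ y`. -/
theorem IsSamworthMaximizer.toReal_tent_eq (hw : ∀ i, 0 < w i) (h : IsSamworthMaximizer X w y)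
    (i : Fin n) : (tent X y (X i)).toReal = y i := by
  have hdens : tentDensity X (fun i => (tent X y (X i)).toReal) = tentDensity X y := by
    funext t
    by_cases ht : t ∈ polytope X
    · rw [tentDensity_of_mem ht, tentDensity_of_mem ht, toReal_tent_tent ht]
    · rw [tentDensity_of_notMem ht, tentDensity_of_notMem ht]
  have hmem : (fun i => (tent X y (X i)).toReal) ∈ samworthBody X := by
    rw [mem_samworthBody_iff, hdens]
    exact (mem_samworthBody_iff X y).1 h.1
  have h1 : w ⬝ᵥ (fun i => (tent X y (X i)).toReal) ≤ w ⬝ᵥ y := h.2 hmem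
  refine le_antisymm ?_ (le_toReal_tent_self i)
  by_contra! hlt
  refine h1.not_gt (Finset.sum_lt_sum (fun j _ => ?_) ⟨i, Finset.mem_univ i, ?_⟩)
  · exact mul_le_mul_of_nonneg_left (le_toReal_tent_self j) (hw j).le
  · exact mul_lt_mul_of_pos_left hlt (hw i)

/-- The squared distance of the square roots of two tent densities is controlled by the midpoint
of the heights. -/
theorem tentDensity_midpoint_add_le (y z : Fin n → ℝ) (t : EuclideanSpace ℝ (Fin d)) :
    tentDensity X (fun i => (y i + z i) / 2) t +
      (√(tentDensity X y t) - √(tentDensity X z t)) ^ 2 / 2 ≤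
      (tentDensity X y t + tentDensity X z t) / 2 := by
  by_cases ht : t ∈ polytope X
  · have h := Real.exp_le_exp.2 (toReal_tent_midpoint_le (y := y) (z := z) ht)
    rw [tentDensity_of_mem ht, tentDensity_of_mem ht, tentDensity_of_mem ht]
    set a := (tent X y t).toReal
    set b := (tent X z t).toReal
    have h1 := Real.sq_sqrt (Real.exp_pos a).le
    have h2 := Real.sq_sqrt (Real.exp_pos b).le
    have h3 : Real.exp ((a + b) / 2) = √(Real.exp a) * √(Real.exp b) := by
      rw [← Real.exp_half, ← Real.exp_half, ← Real.exp_add, add_div]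
    rw [h3] at h
    nlinarith
  · simp [tentDensity_of_notMem ht]

theorem IsSamworthMaximizer.unique (hdim : affineSpan ℝ (range X) = ⊤) (hw : ∀ i, 0 < w i)
    (hw1 : ∑ i, w i = 1) {z : Fin n → ℝ} (hy : IsSamworthMaximizer X w y)
    (hz : IsSamworthMaximizer X w z) : y = z := by
  have hyz : w ⬝ᵥ y = w ⬝ᵥ z := le_antisymm (hz.2 hy.1) (hy.2 hz.1)
  have hIy := hy.integral_eq_one hdim hw1
  have hIz := hz.integral_eq_one hdim hw1
  have hint : Integrable fun t => (tentDensity X y t + tentDensity X z t) / 2 :=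
    ((integrable_tentDensity X y).add (integrable_tentDensity X z)).div_const 2
  have hintm := integrable_tentDensity X fun i => (y i + z i) / 2
  have hle : ∀ t, tentDensity X (fun i => (y i + z i) / 2) t ≤
      (tentDensity X y t + tentDensity X z t) / 2 := fun t => by
    linarith [tentDensity_midpoint_add_le (X := X) y z t,
      sq_nonneg (√(tentDensity X y t) - √(tentDensity X z t))]
  have hI : ∫ t, (tentDensity X y t + tentDensity X z t) / 2 = 1 := by
    rw [integral_div, integral_add (integrable_tentDensity X y) (integrable_tentDensity X z),
      hIy, hIz]
    norm_num
  have hdot : w ⬝ᵥ (fun i => (y i + z i) / 2) = w ⬝ᵥ y := by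
    have : w ⬝ᵥ (fun i => (y i + z i) / 2) = (w ⬝ᵥ y + w ⬝ᵥ z) / 2 := by
      rw [dotProduct, dotProduct, dotProduct, ← Finset.sum_add_distrib, Finset.sum_div]
      exact Finset.sum_congr rfl fun i _ => by ring
    rw [this, ← hyz]
    ring
  have hm : IsSamworthMaximizer X w fun i => (y i + z i) / 2 := by
    refine ⟨(mem_samworthBody_iff X _).2 (hI ▸ integral_mono hintm hint hle), fun u hu => ?_⟩
    exact (hy.2 hu).trans hdot.ge
  have hIm := hm.integral_eq_one hdim hw1
  -- The midpoint is itself a maximizer, so it also has mass one and the nonnegative AM-GM defect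
  -- integrates to zero.
  have hae0 : (fun t => (tentDensity X y t + tentDensity X z t) / 2 -
      tentDensity X (fun i => (y i + z i) / 2) t) =ᵐ[volume] 0 := by
    rw [← integral_eq_zero_iff_of_nonneg (fun t => sub_nonneg.2 (hle t)) (hint.sub hintm)]
    rw [integral_sub hint hintm, hI, hIm, sub_self]
  have hae : tentDensity X y =ᵐ[volume] tentDensity X z := by
    filter_upwards [hae0] with t ht
    have h1 := tentDensity_midpoint_add_le (X := X) y z t
    have h2 : √(tentDensity X y t) - √(tentDensity X z t) = 0 := by
      have ht' : (tentDensity X y t + tentDensity X z t) / 2 -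
        tentDensity X (fun i => (y i + z i) / 2) t = 0 := ht
      rw [← sq_eq_zero_iff]
      exact le_antisymm (by linarith) (sq_nonneg _)
    exact (Real.sqrt_inj (tentDensity_nonneg t) (tentDensity_nonneg t)).1 (sub_eq_zero.1 h2)
  have hpt : ∀ t, tentDensity X y t = tentDensity X z t := fun t => by
    obtain ⟨k, hk, hkP⟩ := exists_tentDensity_lower_bound X y
    obtain ⟨k', hk', hkP'⟩ := exists_tentDensity_lower_bound X z
    exact le_antisymm
      (le_tentDensity_of_ae_le hdim isConcave_extLog_tentDensity hk hkP hae.le t)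
      (le_tentDensity_of_ae_le hdim isConcave_extLog_tentDensity hk' hkP' hae.symm.le t)
  funext i
  have := hpt (X i)
  rwa [tentDensity_of_mem (mem_polytope_self i), tentDensity_of_mem (mem_polytope_self i),
    Real.exp_eq_exp, hy.toReal_tent_eq hw, hz.toReal_tent_eq hw] at this

theorem tentDensity_le_of_isConcave (hg0 : ∀ t, 0 ≤ g t) (hg : IsConcave (extLog g))
    (hpos : ∀ i, 0 < g (X i)) (t : EuclideanSpace ℝ (Fin d)) :
    tentDensity X (fun i => Real.log (g (X i))) t ≤ g t := by
  have h := (tent_isLeast X fun i => Real.log (g (X i))).2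
    ⟨hg, fun t => by rw [extLog, Ne, ENNReal.log_eq_top_iff]; exact ENNReal.ofReal_ne_top,
      fun i => (ENNReal.log_ofReal_of_pos (hpos i)).ge⟩ t
  have h' := EReal.exp_monotone h
  rwa [exp_tent, extLog, ENNReal.exp_log, ENNReal.ofReal_le_ofReal_iff (hg0 t)] at h'

theorem IsLogConcaveDensity.log_mem_samworthBody (hg : IsLogConcaveDensity g)
    (hpos : ∀ i, 0 < g (X i)) : (fun i => Real.log (g (X i))) ∈ samworthBody X := by
  rw [mem_samworthBody_iff, ← hg.integral_eq_one]
  exact integral_mono (integrable_tentDensity X _) hg.integrable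
    (tentDensity_le_of_isConcave hg.nonneg hg.log_concave hpos)

theorem logLikelihood_of_pos (hpos : ∀ i, 0 < g (X i)) :
    logLikelihood X w g = ((w ⬝ᵥ fun i => Real.log (g (X i)) : ℝ) : EReal) := by
  have : ∀ i, (w i : EReal) * extLog g (X i) = ((w i * Real.log (g (X i)) : ℝ) : EReal) :=
    fun i => by rw [extLog, ENNReal.log_ofReal_of_pos (hpos i), EReal.coe_mul]
  simp only [logLikelihood, this, dotProduct]
  exact (map_sum (⟨⟨Real.toEReal, EReal.coe_zero⟩, EReal.coe_add⟩ : ℝ →+ EReal) _ _).symm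

theorem logLikelihood_eq_bot (hw : ∀ i, 0 < w i) {i : Fin n} (hi : g (X i) ≤ 0) :
    logLikelihood X w g = ⊥ := by
  -- In `EReal`, `⊥` absorbs every summand, even `⊤`, so the remaining terms need no inspection.
  rw [logLikelihood, ← Finset.add_sum_erase _ _ (Finset.mem_univ i), extLog,
    ENNReal.ofReal_of_nonpos hi, ENNReal.log_zero, EReal.coe_mul_bot_of_pos (hw i), EReal.bot_add]

theorem IsSamworthMaximizer.logLikelihood_tentDensity (hw : ∀ i, 0 < w i)
    (h : IsSamworthMaximizer X w y) :
    logLikelihood X w (tentDensity X y) = ((w ⬝ᵥ y : ℝ) : EReal) := by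
  have hval : ∀ i, tentDensity X y (X i) = Real.exp (y i) := fun i => by
    rw [tentDensity_of_mem (mem_polytope_self i), h.toReal_tent_eq hw]
  rw [logLikelihood_of_pos fun i => by rw [hval]; exact Real.exp_pos _]
  simp_rw [hval, Real.log_exp]

theorem IsSamworthMaximizer.isLogConcaveMLE (hdim : affineSpan ℝ (range X) = ⊤)
    (hw : ∀ i, 0 < w i) (hw1 : ∑ i, w i = 1) (h : IsSamworthMaximizer X w y) :
    IsLogConcaveMLE X w (tentDensity X y) := by
  refine ⟨⟨tentDensity_nonneg, integrable_tentDensity X y, h.integral_eq_one hdim hw1,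
    isConcave_extLog_tentDensity⟩, fun g hg => ?_⟩
  by_cases hpos : ∀ i, 0 < g (X i)
  · rw [logLikelihood_of_pos hpos, h.logLikelihood_tentDensity hw, EReal.coe_le_coe_iff]
    exact h.2 (hg.log_mem_samworthBody hpos)
  · push Not at hpos
    obtain ⟨i, hi⟩ := hpos
    rw [logLikelihood_eq_bot hw hi]
    exact bot_le

theorem IsLogConcaveMLE.eq_tentDensity (hdim : affineSpan ℝ (range X) = ⊤)
    (hw : ∀ i, 0 < w i) (hw1 : ∑ i, w i = 1) (h : IsSamworthMaximizer X w y)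
    (hg : IsLogConcaveMLE X w g) : g = tentDensity X y := by
  have hge := hg.2 _ (h.isLogConcaveMLE hdim hw hw1).1
  rw [h.logLikelihood_tentDensity hw] at hge
  have hpos : ∀ i, 0 < g (X i) := by
    by_contra! hne
    obtain ⟨i, hi⟩ := hne
    rw [logLikelihood_eq_bot hw hi, le_bot_iff] at hge
    exact EReal.coe_ne_bot _ hge
  rw [logLikelihood_of_pos hpos, EReal.coe_le_coe_iff] at hge
  -- By uniqueness these heights are `y`, which places `tentDensity X y` below `g`.
  have hmax : IsSamworthMaximizer X w fun i => Real.log (g (X i)) :=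
    ⟨hg.1.log_mem_samworthBody hpos, fun z hz => (h.2 hz).trans hge⟩
  have hle := tentDensity_le_of_isConcave hg.1.nonneg hg.1.log_concave hpos
  rw [hmax.unique hdim hw hw1 h] at hle
  have hae : (fun t => g t - tentDensity X y t) =ᵐ[volume] 0 := by
    rw [← integral_eq_zero_iff_of_nonneg (fun t => sub_nonneg.2 (hle t))
      (hg.1.integrable.sub (integrable_tentDensity X y)),
      integral_sub hg.1.integrable (integrable_tentDensity X y), hg.1.integral_eq_one,
      h.integral_eq_one hdim hw1, sub_self]
  obtain ⟨k, hk, hkP⟩ := exists_tentDensity_lower_bound X y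
  funext t
  refine le_antisymm (le_tentDensity_of_ae_le hdim hg.1.log_concave hk
    (fun s hs => (hkP s hs).trans (hle s)) ?_ t) (hle t)
  filter_upwards [hae] with s hs
  exact (sub_eq_zero.1 hs).le

end Likelihood

end LogConcaveMLE

theorem theorem2p2 {d n : ℕ} (X : Fin n → EuclideanSpace ℝ (Fin d))
    (hX : Function.Injective X) (hdim : affineSpan ℝ (Set.range X) = ⊤)
    (w : Fin n → ℝ) (hw : ∀ i, 0 < w i) (hw1 : ∑ i, w i = 1) :
    BddAbove ((fun y : Fin n → ℝ => w ⬝ᵥ y) '' LogConcaveMLE.samworthBody X) ∧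
    ∃ ystar : Fin n → ℝ,
      LogConcaveMLE.IsSamworthMaximizer X w ystar ∧
      (∀ y, LogConcaveMLE.IsSamworthMaximizer X w y → y = ystar) ∧
      LogConcaveMLE.IsLogConcaveMLE X w (LogConcaveMLE.tentDensity X ystar) ∧
      ∀ f, LogConcaveMLE.IsLogConcaveMLE X w f → f = LogConcaveMLE.tentDensity X ystar := by
  obtain ⟨y, hy⟩ := LogConcaveMLE.exists_isSamworthMaximizer hdim hw hw1
  exact ⟨LogConcaveMLE.bddAbove_dotProduct_samworthBody hdim hw hw1, y, hy,
    fun z hz => hz.unique hdim hw hw1 hy, hy.isLogConcaveMLE hdim hw hw1,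
    fun f hf => hf.eq_tentDensity hdim hw hw1 hy⟩
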